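/- Let $X$ be a systolic complex, that is, a flag simplicial complex whose $1$-skeleton $G$ is a bridged graph: $G$ is connected and every isometric cycle in $G$ has length $3$. Let $d$ be the path metric of $G$ on the vertex set $V$ of $X$. For $u,v\in V$ and $0\le k\le d(u,v)$, let $L_k(u,v)$ be the subgraph of $G$ induced by all vertices $x$ with $d(u,x)=k$ and $d(x,v)=d(u,v)-k$ (the $k$-level of the interval between $u$ and $v$), with its own path metric. Suppose that (i) $X$ is uniformly locally finite: there is a uniform bound on the number of simplices that contain a given vertex of $X$; (ii) $X$ is fit: there are constants $B,C>0$ such that for all $u,v\in V$ and $0\le k\le d(u,v)$ the level $L_k(u,v)$ is $(B,C)$-quasi-isometric to a segment, that is, there are a finite path graph $P$ and a map $f\colon L_k(u,v)\to P$ such that every vertex of $P$ is within distance $C$ of the image of $f$, and $B^{-1}d_{L_k(u,v)}(x,x')-C\le d_P(f(x),f(x'))\le B\,d_{L_k(u,v)}(x,x')+C$ for all vertices $x,x'$ of $L_k(u,v)$. Then the uniformly discrete metric space $(V,d)$ has Yu's Property A: for all $\varepsilon,R>0$ there are finite sets $A_x\subset V\times\mathbb N$ $(x\in V)$ and a constant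 $S>0$ such that - if $d(x,y)\le R$, then $A_x\cap A_y\ne\emptyset$ and $\dfrac{|A_x\triangle A_y|}{|A_x\cap A_y|}\le\varepsilon$; - $A_x\subseteq B_S(x)\times\mathbb N$ for every $x\in V$, where $B_S(x)=\{y\in V: d(x,y)\le S\}$. -/

import Mathlib

/-! ### Bridged graphs and intervals -/

namespace SimpleGraph

/-- A graph is bridged if it is connected and each isometric cycle in it has length `3`.
An isometric cycle of length `n ≥ 3` is a distance-preserving copy of the cycle graph `C_n`. -/
def IsBridged {V : Type*} (G : SimpleGraph V) : Prop :=
  G.Connected ∧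
    ∀ n : ℕ, 3 ≤ n → ∀ c : Fin n → V,
      (∀ i j : Fin n, G.dist (c i) (c j) = (cycleGraph n).dist i j) → n = 3

/-- The (metric) interval `I(u, v)`: all vertices on shortest `(u, v)`-paths. -/
def interval {V : Type*} (G : SimpleGraph V) (u v : V) : Set V :=
  {x | G.dist u x + G.dist x v = G.dist u v}

/-- The vertex set of the `k`-level of the interval `I(u, v)`. Here `k ≤ d(u, v)` is intended;
the second distance `d(x, v) = d(u, v) - k` is then automatic. -/
def levelSet {V : Type*} (G : SimpleGraph V) (u v : V) (k : ℕ) : Set V :=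
  {x | x ∈ G.interval u v ∧ G.dist u x = k}

/-- The `k`-level of the interval `I(u, v)`, as an induced subgraph of `G`. -/
def level {V : Type*} (G : SimpleGraph V) (u v : V) (k : ℕ) :
    SimpleGraph (G.levelSet u v k) :=
  G.induce (G.levelSet u v k)

/-- `f` is a `(B, C)`-quasi-isometry between the vertex sets of the connected graphs `H` and `K`,
each with its own path metric. -/
def IsQuasiIsometry {V W : Type*} (H : SimpleGraph V) (K : SimpleGraph W) (B C : ℝ)
    (f : V → W) : Prop :=
  (∀ y : W, ∃ x : V, (K.dist (f x) y : ℝ) ≤ C) ∧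
    ∀ x x' : V, B⁻¹ * (H.dist x x' : ℝ) - C ≤ (K.dist (f x) (f x') : ℝ) ∧
      (K.dist (f x) (f x') : ℝ) ≤ B * (H.dist x x' : ℝ) + C

/-- `H` is `(B, C)`-quasi-isometric to a segment, i.e. to a path of some finite length `m`
(the path graph on `m + 1` vertices). -/
def IsQuasiSegment {V : Type*} (H : SimpleGraph V) (B C : ℝ) : Prop :=
  ∃ (m : ℕ) (f : V → Fin (m + 1)), IsQuasiIsometry H (pathGraph (m + 1)) B C f

/-- The vertex set of a connected graph as a metric space, with the path metric. -/
noncomputable abbrev pathMetric {V : Type*} (G : SimpleGraph V) (hG : G.Connected) :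
    MetricSpace V where
  dist u v := (G.dist u v : ℝ)
  dist_self u := by simp
  dist_comm u v := by rw [G.dist_comm]
  dist_triangle u v w := by exact_mod_cast hG.dist_triangle
  eq_of_dist_eq_zero := by
    intro u v h
    exact hG.dist_eq_zero_iff.mp (by exact_mod_cast h)

end SimpleGraph

/-! ### Systolic complexes -/

namespace AbstractSimplicialComplex

open Classical in
/-- The `1`-skeleton of a simplicial complex, as a graph on its vertices. -/
def oneSkeleton {V : Type*} (X : AbstractSimplicialComplex V) : SimpleGraph V where
  Adj u v := u ≠ v ∧ ({u, v} : Finset V) ∈ X.faces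
  symm := ⟨fun u v h => ⟨h.1.symm, by rw [Finset.pair_comm]; exact h.2⟩⟩
  loopless := ⟨fun _ h => h.1 rfl⟩

/-- A simplicial complex is flag if each nonempty finite set of pairwise adjacent vertices
spans a simplex. -/
def IsFlag {V : Type*} (X : AbstractSimplicialComplex V) : Prop :=
  ∀ s : Finset V, s.Nonempty → X.oneSkeleton.IsClique (s : Set V) → s ∈ X.faces

/-- A systolic complex is a flag simplicial complex whose `1`-skeleton is a bridged graph. -/
structure IsSystolic {V : Type*} (X : AbstractSimplicialComplex V) : Prop where
  isFlag : X.IsFlag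
  isBridged : X.oneSkeleton.IsBridged

/-- There is a uniform bound on the number of simplices that contain a given vertex. -/
def IsUniformlyLocallyFinite {V : Type*} (X : AbstractSimplicialComplex V) : Prop :=
  ∃ D : ℕ, ∀ v : V, {s : Finset V | s ∈ X.faces ∧ v ∈ s}.encard ≤ D

/-- The complex (assumed systolic where this is used) is fit if, for some `B, C > 0`, each level
of each interval of its `1`-skeleton is `(B, C)`-quasi-isometric to a segment. -/
def IsFit {V : Type*} (X : AbstractSimplicialComplex V) : Prop :=
  ∃ B C : ℝ, 0 < B ∧ 0 < C ∧
    ∀ (u v : V) (k : ℕ), k ≤ X.oneSkeleton.dist u v →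
      (X.oneSkeleton.level u v k).IsQuasiSegment B C

end AbstractSimplicialComplex

/-! ### Yu's Property A -/

/-- Some positive constant bounds all distances between distinct points from below. -/
def IsUniformlyDiscreteSpace (X : Type*) [MetricSpace X] : Prop :=
  ∃ c : ℝ, 0 < c ∧ ∀ x y : X, x ≠ y → c ≤ dist x y

open Classical in
/-- The metric space `X` is uniformly discrete and has Yu's Property A. The bound on the ratio
`|A_x ∆ A_y| / |A_x ∩ A_y|` includes that its denominator is not zero. -/
def HasPropertyA (X : Type*) [MetricSpace X] : Prop :=
  IsUniformlyDiscreteSpace X ∧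
    ∀ ε R : ℝ, 0 < ε → 0 < R →
      ∃ (A : X → Finset (X × ℕ)) (S : ℝ), 0 < S ∧
        (∀ x y : X, dist x y ≤ R →
          (A x ∩ A y).Nonempty ∧
            ((symmDiff (A x) (A y)).card : ℝ) / ((A x ∩ A y).card : ℝ) ≤ ε) ∧
        ∀ x : X, ∀ p ∈ A x, p.1 ∈ Metric.closedBall x S

/-!
Fix a base point `o`. In a bridged graph the neighbours of a vertex that are closer to `o` form a
clique, and adjacent vertices at the same distance from `o` have a common neighbour closer to `o`
(`IsBridged.neighborCondition_and_triangleCondition`). Both facts are proved by a simultaneous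
induction on the distance to `o`: a first failure, together with geodesics to `o`, spans a cycle
all of whose antipodal pairs are as far apart as possible, and such a cycle is isometric
(`Connected.dist_eq_cycleGraph_dist_of_antipodal`).

It follows that the neighbours of `y` closer to `o` have a common neighbour `p y` that is closer
still, that `p` is a `1`-Lipschitz map, and that `p y` lies on geodesics to `o` from every vertex
of the `1`-ball around `y` (`IsBridged.exists_contraction`). By induction `p^[k] x` lies on
geodesics to `o` from every vertex of the `k`-ball around `x`. So the set `F x k` of all vertices
within a fixed distance `6n` that lie on geodesics to `o` from all vertices of the `k`-ball around
`x` is nonempty for `k ≤ 2n`. Evidently `F x (k + R) ⊆ F y k` if `d(x, y) ≤ R`.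

The size of `F x 0`, a part of the interval between `x` and `o`, is at most quadratic in `n`: the
level at distance `j` from `x` has diameter at most `j` in its own metric, because paths can be
pushed from one level to the next (`IsBridged.exists_walk_level`), so that a level that is
quasi-isometric to a segment has linearly many vertices in a graph of bounded degree.

Hence `|F x 0| ≥ |F x 1| ≥ ⋯` is a decreasing sequence between `1` and a polynomial in `n`, and its
successive ratios are close to `1` on average. The averages over `k < n` of the normalized
counting measures of `F x k` are therefore almost invariant, which is Property A
(`hasPropertyA_of_decreasing`).
-/

namespace SimpleGraph

variable {V : Type*} {G : SimpleGraph V}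

/-! ### Isometric cycles -/

lemma cycleGraph_adj_succ_mod {n : ℕ} (hn : 2 ≤ n) (a : ℕ) :
    (cycleGraph n).Adj ⟨a % n, Nat.mod_lt _ (by omega)⟩ ⟨(a + 1) % n, Nat.mod_lt _ (by omega)⟩ := by
  rw [cycleGraph_adj']
  right
  have hr : a % n < n := Nat.mod_lt _ (by omega)
  simp only [Fin.sub_def]
  rw [Nat.add_mod a 1 n, Nat.mod_eq_of_lt (show 1 < n by omega)]
  by_cases h : a % n + 1 < n
  · rw [Nat.mod_eq_of_lt h, show n - a % n + (a % n + 1) = 1 + n by omega, Nat.add_mod_right,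
      Nat.mod_eq_of_lt (by omega)]
  · have h' : a % n + 1 = n := by omega
    rw [h', Nat.mod_self, show n - a % n + 0 = 1 by omega, Nat.mod_eq_of_lt (by omega)]

lemma cycleGraph_exists_walk_add_mod {n : ℕ} (hn : 2 ≤ n) (a k : ℕ) :
    ∃ p : (cycleGraph n).Walk ⟨a % n, Nat.mod_lt _ (by omega)⟩
      ⟨(a + k) % n, Nat.mod_lt _ (by omega)⟩, p.length = k := by
  induction k with
  | zero => exact ⟨Walk.nil, rfl⟩
  | succ k ih =>
    obtain ⟨p, hp⟩ := ih
    exact ⟨p.concat (cycleGraph_adj_succ_mod hn (a + k)), by simp [hp]⟩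

lemma cycleGraph_reachable_and_dist_le {n : ℕ} (hn : 2 ≤ n) {i j : Fin n} {k : ℕ}
    (h : (i.val + k) % n = j.val) : (cycleGraph n).Reachable i j ∧ (cycleGraph n).dist i j ≤ k := by
  obtain ⟨p, hp⟩ := cycleGraph_exists_walk_add_mod hn i.val k
  have hi : (⟨i.val % n, Nat.mod_lt _ (by omega)⟩ : Fin n) = i :=
    Fin.ext (Nat.mod_eq_of_lt i.isLt)
  have hj : (⟨(i.val + k) % n, Nat.mod_lt _ (by omega)⟩ : Fin n) = j := Fin.ext h
  have hq : (p.copy hi hj).length = k := by simp [hp]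
  exact ⟨(p.copy hi hj).reachable, hq ▸ dist_le _⟩

/-- A closed sequence of `n ∈ {2N, 2N + 1}` vertices with steps of length at most `1` is an
isometric cycle as soon as its antipodal points are at distance at least `N`: a shortcut between
any two of its points would shorten the distance between two antipodal ones. -/
lemma Connected.dist_eq_cycleGraph_dist_of_antipodal (hG : G.Connected) {n N : ℕ} (hn : 3 ≤ n)
    (hnN : n = 2 * N ∨ n = 2 * N + 1) (c : ℕ → V)
    (h1 : ∀ i < n, G.dist (c i) (c ((i + 1) % n)) ≤ 1)
    (h2 : ∀ i < n, N ≤ G.dist (c i) (c ((i + N) % n))) (i j : Fin n) :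
    G.dist (c i) (c j) = (cycleGraph n).dist i j := by
  have hadj : ∀ u v : Fin n, (cycleGraph n).Adj u v → G.dist (c u) (c v) ≤ 1 := by
    have key : ∀ u v : Fin n, (v - u).val = 1 → G.dist (c u) (c v) ≤ 1 := by
      intro u v h
      have hv : v.val = (u.val + 1) % n := by
        have hu := u.isLt
        have hv := v.isLt
        simp only [Fin.sub_def] at h
        by_cases hle : u.val ≤ v.val
        · rw [show n - u.val + v.val = (v.val - u.val) + n by omega, Nat.add_mod_right,
            Nat.mod_eq_of_lt (by omega)] at h
          rw [Nat.mod_eq_of_lt (by omega)]; omega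
        · rw [Nat.mod_eq_of_lt (by omega)] at h
          have : u.val + 1 = n := by omega
          rw [this, Nat.mod_self]; omega
      rw [hv]; exact h1 u u.isLt
    intro u v h
    rw [cycleGraph_adj'] at h
    rcases h with h | h
    · rw [G.dist_comm]; exact key v u h
    · exact key u v h
  have hwalk : ∀ {u v : Fin n} (p : (cycleGraph n).Walk u v), G.dist (c u) (c v) ≤ p.length := by
    intro u v p
    induction p with
    | nil => simp
    | cons h p ih =>
      rename_i u w v
      have := hG.dist_triangle (u := c u) (v := c w) (w := c v)
      have := hadj _ _ h
      rw [Walk.length_cons]; omega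
  have hup : ∀ (u v : Fin n) (k : ℕ), (u.val + k) % n = v.val → G.dist (c u) (c v) ≤ k := by
    intro u v k h
    obtain ⟨p, hp⟩ := (cycleGraph_reachable_and_dist_le (by omega) h).1.exists_walk_length_eq_dist
    have := (cycleGraph_reachable_and_dist_le (by omega) h).2
    have := hwalk p
    omega
  have key : ∀ (u v : Fin n) (k : ℕ), k ≤ N → (u.val + k) % n = v.val →
      G.dist (c u) (c v) = (cycleGraph n).dist u v := by
    intro u v k hk h
    obtain ⟨hr, hle⟩ := cycleGraph_reachable_and_dist_le (by omega) h
    obtain ⟨p, hp⟩ := hr.exists_walk_length_eq_dist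
    have hp' := hwalk p
    have hw : (v.val + (N - k)) % n = (u.val + N) % n := by
      rw [← h, Nat.mod_add_mod]; congr 1; omega
    have h3 := hup v ⟨(u.val + N) % n, Nat.mod_lt _ (by omega)⟩ (N - k) hw
    have h4 := h2 u u.isLt
    have := hG.dist_triangle (u := c u) (v := c v) (w := c ((u.val + N) % n))
    simp only at h3
    omega
  have main : ∀ u v : Fin n, u.val ≤ v.val → G.dist (c u) (c v) = (cycleGraph n).dist u v := by
    intro u v huv
    have hv := v.isLt
    by_cases h : v.val - u.val ≤ N
    · exact key u v _ h (by rw [Nat.mod_eq_of_lt (by omega)]; omega)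
    · rw [G.dist_comm, (cycleGraph n).dist_comm]
      refine key v u (n - (v.val - u.val)) (by omega) ?_
      rw [show v.val + (n - (v.val - u.val)) = u.val + n by omega, Nat.add_mod_right,
        Nat.mod_eq_of_lt u.isLt]
  rcases le_total i.val j.val with h | h
  · exact main i j h
  · rw [G.dist_comm, (cycleGraph n).dist_comm]; exact main j i h

/-- In a bridged graph, two paths of length `N ≥ 2` with common ends do not form an isometric
cycle of length `2N`. -/
lemma IsBridged.false_of_even_cycle (hG : G.IsBridged) {N : ℕ} (hN : 2 ≤ N) (Y Z : ℕ → V)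
    (hY : ∀ k < N, G.dist (Y k) (Y (k + 1)) ≤ 1) (hZ : ∀ k < N, G.dist (Z k) (Z (k + 1)) ≤ 1)
    (h0 : Y 0 = Z 0) (hN' : Y N = Z N) (h : ∀ i ≤ N, N ≤ G.dist (Y i) (Z (N - i))) : False := by
  have key := hG.2 (2 * N) (by omega) (fun i => if i.val ≤ N then Y i else Z (2 * N - i))
    (hG.1.dist_eq_cycleGraph_dist_of_antipodal (n := 2 * N) (N := N) (by omega) (Or.inl rfl)
      (fun i => if i ≤ N then Y i else Z (2 * N - i)) ?_ ?_)
  · omega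
  · intro i hi
    rcases lt_trichotomy i N with h1 | h1 | h1
    · rw [Nat.mod_eq_of_lt (by omega), if_pos (by omega), if_pos (by omega)]; exact hY i h1
    · rw [Nat.mod_eq_of_lt (by omega), if_pos (by omega), if_neg (by omega), h1, hN', G.dist_comm]
      have := hZ (N - 1) (by omega)
      rwa [show N - 1 + 1 = N by omega, show N - 1 = 2 * N - (N + 1) by omega] at this
    · by_cases h2 : i + 1 = 2 * N
      · rw [h2, Nat.mod_self, if_neg (by omega), if_pos (by omega), h0, G.dist_comm,
          show 2 * N - i = 0 + 1 by omega]
        exact hZ 0 (by omega)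
      · rw [Nat.mod_eq_of_lt (by omega), if_neg (by omega), if_neg (by omega), G.dist_comm,
          show 2 * N - i = 2 * N - (i + 1) + 1 by omega]
        exact hZ _ (by omega)
  · intro i hi
    by_cases hi0 : i = 0
    · subst hi0
      have := h 0 (by omega)
      rw [Nat.mod_eq_of_lt (by omega), if_pos (by omega), if_pos (by omega), zero_add, hN']
      simpa using this
    · by_cases h1 : i < N
      · rw [Nat.mod_eq_of_lt (by omega), if_pos (by omega), if_neg (by omega),
          show 2 * N - (i + N) = N - i by omega]
        exact h i (by omega)
      · rw [show i + N = i - N + 2 * N by omega, Nat.add_mod_right, Nat.mod_eq_of_lt (by omega),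
          if_pos (show i - N ≤ N by omega), G.dist_comm]
        have := h (i - N) (by omega)
        by_cases h2 : i ≤ N
        · have h3 : i = N := by omega
          subst h3
          rw [if_pos le_rfl, hN']; simpa using this
        · rw [if_neg h2, show 2 * N - i = N - (i - N) by omega]; exact this

/-- In a bridged graph, two paths of length `N ≥ 2` with a common end and adjacent other ends do
not form an isometric cycle of length `2N + 1`. -/
lemma IsBridged.false_of_odd_cycle (hG : G.IsBridged) {N : ℕ} (hN : 2 ≤ N) (X Y : ℕ → V)
    (hX : ∀ k < N, G.dist (X k) (X (k + 1)) ≤ 1) (hY : ∀ k < N, G.dist (Y k) (Y (k + 1)) ≤ 1)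
    (h0 : X 0 = Y 0) (hN' : G.dist (X N) (Y N) ≤ 1)
    (h : ∀ i ≤ N, N ≤ G.dist (X i) (Y (N - i)))
    (h' : ∀ i ≤ N, 1 ≤ i → N ≤ G.dist (X i) (Y (N + 1 - i))) : False := by
  have key := hG.2 (2 * N + 1) (by omega)
    (fun i => if i.val ≤ N then Y i else X (2 * N + 1 - i))
    (hG.1.dist_eq_cycleGraph_dist_of_antipodal (n := 2 * N + 1) (N := N) (by omega) (Or.inr rfl)
      (fun i => if i ≤ N then Y i else X (2 * N + 1 - i)) ?_ ?_)
  · omega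
  · intro i hi
    rcases lt_trichotomy i N with h1 | h1 | h1
    · rw [Nat.mod_eq_of_lt (by omega), if_pos (by omega), if_pos (by omega)]; exact hY i h1
    · rw [Nat.mod_eq_of_lt (by omega), if_pos (by omega), if_neg (by omega), h1, G.dist_comm,
        show 2 * N + 1 - (N + 1) = N by omega]
      exact hN'
    · by_cases h2 : i = 2 * N
      · rw [h2, Nat.mod_self, if_neg (by omega), if_pos (by omega), ← h0, G.dist_comm,
          show 2 * N + 1 - 2 * N = 0 + 1 by omega]
        exact hX 0 (by omega)
      · rw [Nat.mod_eq_of_lt (by omega), if_neg (by omega), if_neg (by omega), G.dist_comm,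
          show 2 * N + 1 - i = 2 * N + 1 - (i + 1) + 1 by omega]
        exact hX _ (by omega)
  · intro i hi
    by_cases hi0 : i = 0
    · subst hi0
      have := h 0 (by omega)
      rw [Nat.mod_eq_of_lt (by omega), if_pos (by omega), if_pos (by omega), zero_add, ← h0]
      simpa using this
    · by_cases h1 : i ≤ N
      · rw [Nat.mod_eq_of_lt (by omega), if_pos (by omega), if_neg (by omega),
          show 2 * N + 1 - (i + N) = N + 1 - i by omega, G.dist_comm]
        have := h' (N + 1 - i) (by omega) (by omega)
        rwa [show N + 1 - (N + 1 - i) = i by omega] at this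
      · rw [show i + N = i - (N + 1) + (2 * N + 1) by omega, Nat.add_mod_right,
          Nat.mod_eq_of_lt (by omega), if_neg h1, if_pos (by omega)]
        have := h (2 * N + 1 - i) (by omega)
        rwa [show N - (2 * N + 1 - i) = i - (N + 1) by omega] at this

/-- A bridged graph has no induced `4`-cycle. -/
lemma IsBridged.false_of_square (hG : G.IsBridged) {a b c d : V} (hab : G.Adj a b)
    (hbc : G.Adj b c) (hcd : G.Adj c d) (hda : G.Adj d a) (hac : 2 ≤ G.dist a c)
    (hbd : 2 ≤ G.dist b d) : False := by
  rw [← dist_eq_one_iff_adj] at hab hbc hcd hda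
  refine hG.false_of_even_cycle le_rfl (fun k => if k = 0 then a else if k = 1 then b else c)
    (fun k => if k = 0 then a else if k = 1 then d else c) ?_ ?_ rfl rfl ?_
  · intro k hk
    interval_cases k <;> simp [hab, hbc]
  · intro k hk
    interval_cases k <;> simp [G.dist_comm (u := a) (v := d),
      G.dist_comm (u := d) (v := c), hcd, hda]
  · intro k hk
    interval_cases k <;> simp [hac, hbd, G.dist_comm (u := c) (v := a)]

/-- A bridged graph has no induced `5`-cycle. -/
lemma IsBridged.false_of_pentagon (hG : G.IsBridged) {a b c d e : V} (hab : G.Adj a b)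
    (hbc : G.Adj b c) (hcd : G.Adj c d) (hde : G.Adj d e) (hea : G.Adj e a)
    (hac : 2 ≤ G.dist a c) (had : 2 ≤ G.dist a d) (hbd : 2 ≤ G.dist b d) (hbe : 2 ≤ G.dist b e)
    (hce : 2 ≤ G.dist c e) : False := by
  rw [← dist_eq_one_iff_adj] at hab hbc hcd hde hea
  refine hG.false_of_odd_cycle le_rfl (fun k => if k = 0 then a else if k = 1 then b else c)
    (fun k => if k = 0 then a else if k = 1 then e else d) ?_ ?_ rfl ?_ ?_ ?_
  · intro k hk
    interval_cases k <;> simp [hab, hbc]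
  · intro k hk
    interval_cases k <;> simp [G.dist_comm (u := a) (v := e),
      G.dist_comm (u := e) (v := d), hde, hea]
  · simp [hcd]
  · intro k hk
    interval_cases k <;> simp [had, hbe, G.dist_comm (u := c) (v := a), hac]
  · intro k hk hk1
    interval_cases k <;> simp [hbd, hce]

/-! ### Local convexity of balls in bridged graphs -/

/-- The neighbours of a vertex at distance `n` from `o` that are closer to `o` are pairwise equal
or adjacent. -/
def NeighborCondition (G : SimpleGraph V) (n : ℕ) : Prop :=
  ∀ o x y z, G.dist o x = n → G.Adj x y → G.Adj x z → G.dist o y + 1 = n → G.dist o z + 1 = n →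
    G.dist y z ≤ 1

/-- Adjacent vertices at distance `n` from `o` have a common neighbour that is closer to `o`. -/
def TriangleCondition (G : SimpleGraph V) (n : ℕ) : Prop :=
  ∀ o x y, G.dist o x = n → G.dist o y = n → G.Adj x y →
    ∃ w, G.Adj x w ∧ G.Adj y w ∧ G.dist o w + 1 = n

lemma Connected.adj_of_dist_le_one (hG : G.Connected) {u v : V} (h : G.dist u v ≤ 1)
    (hne : u ≠ v) : G.Adj u v := by
  have := hG.pos_dist_of_ne hne
  exact dist_eq_one_iff_adj.mp (by omega)

/-- A path of minimal length from `o` to `x`, as a sequence of vertices. -/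
lemma Connected.exists_geodesic (hG : G.Connected) (o x : V) :
    ∃ X : ℕ → V, X 0 = o ∧ X (G.dist o x) = x ∧
      (∀ k ≤ G.dist o x, G.dist o (X k) = k ∧ G.dist (X k) x + k = G.dist o x) ∧
      ∀ k < G.dist o x, G.dist (X k) (X (k + 1)) ≤ 1 := by
  obtain ⟨p, hp⟩ := hG.exists_walk_length_eq_dist o x
  refine ⟨p.getVert, p.getVert_zero, by rw [← hp]; exact p.getVert_length, ?_, ?_⟩
  · intro k hk
    have h1 := dist_le (p.take k)
    have h2 := dist_le (p.drop k)
    have h3 := hG.dist_triangle (u := o) (v := p.getVert k) (w := x)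
    rw [Walk.take_length] at h1
    rw [Walk.drop_length] at h2
    omega
  · intro k hk
    rw [dist_eq_one_iff_adj.mpr (p.adj_getVert_succ (by omega))]

lemma Connected.exists_adj_dist_add_one (hG : G.Connected) {o x : V} (h : 0 < G.dist o x) :
    ∃ w, G.Adj x w ∧ G.dist o w + 1 = G.dist o x := by
  obtain ⟨X, -, h1, h2, h3⟩ := hG.exists_geodesic o x
  have h4 := h3 (G.dist o x - 1) (by omega)
  have h5 := h2 (G.dist o x - 1) (by omega)
  rw [show G.dist o x - 1 + 1 = G.dist o x by omega, h1] at h4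
  refine ⟨X (G.dist o x - 1), dist_eq_one_iff_adj.mp ?_, by omega⟩
  rw [G.dist_comm]; omega

/-- Two adjacent vertices at distance `N` from `o` without a common neighbour closer to `o` would
span, with any geodesics to `o`, an isometric cycle of length `2N + 1`. The antipodal pairs of
that cycle are visited in the order in which each is obtained from the previous one by moving one
of the two points by one step; the neighbor condition keeps the distance equal to `N`. -/
lemma IsBridged.triangleCondition_of_lt (hG : G.IsBridged) {N : ℕ} (hN : 2 ≤ N)
    (hA : G.NeighborCondition N) (hB : G.TriangleCondition (N - 1)) : G.TriangleCondition N := by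
  intro o x y hx hy hxy
  by_contra! hno
  have tri := fun a b c => hG.1.dist_triangle (u := a) (v := b) (w := c)
  have sy := fun a b => G.dist_comm (u := a) (v := b)
  have e := fun (a b : V) (h : G.Adj a b) => dist_eq_one_iff_adj.mpr h
  have hxy1 := e _ _ hxy
  have key : ∀ m a b, G.dist o a + G.dist a x = N → G.dist o b + G.dist b y = N →
      (G.dist o a + G.dist o b = N ∨ G.dist o a + G.dist o b = N + 1) →
      G.dist a x + G.dist o b = m → N ≤ G.dist a b := by
    intro m
    induction m with
    | zero =>
      intro a b ha hb hab hm
      have hb' : o = b := (hG.1.dist_eq_zero_iff).mp (by omega)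
      have ha' : a = x := (hG.1.dist_eq_zero_iff).mp (by omega)
      subst hb' ha'
      rw [sy]; omega
    | succ m ih =>
      intro a b ha hb hab hm
      by_contra hlt
      rcases hab with hab | hab
      · obtain ⟨a', haa', ha'⟩ := hG.1.exists_adj_dist_add_one (o := x) (x := a)
          (by have := sy a x; omega)
        have := e _ _ haa'
        have := sy a x
        have := sy a' x
        have := tri o a a'
        have := tri o a' x
        have := ih a' b (by omega) hb (by omega) (by omega)
        have := tri a' x b
        have := tri x y b
        have := sy b y
        have := tri a' a b
        have := sy a a'
        have := sy a b
        have := sy a' b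
        by_cases hi : G.dist x a' = 0
        · have hxa : x = a' := hG.1.dist_eq_zero_iff.mp hi
          subst hxa
          have := hA b x a y (by omega) haa'.symm hxy (by omega) (by omega)
          have hay : a ≠ y := by rintro rfl; omega
          exact hno a haa'.symm (hG.1.adj_of_dist_le_one this hay).symm (by omega)
        · obtain ⟨a'', haa'', ha''⟩ := hG.1.exists_adj_dist_add_one (o := x) (x := a') (by omega)
          have := e _ _ haa''
          have := tri b y a''
          have := tri y x a''
          have := sy x y
          have := tri b a'' a'
          have := sy a' a''
          have := hA b a' a a'' (by omega) haa'.symm haa'' (by omega) (by omega)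
          have := tri o a a''
          have := tri o a'' x
          have := sy x a''
          omega
      · obtain ⟨b', hbb', hb'⟩ := hG.1.exists_adj_dist_add_one (o := o) (x := b)
          (by have := tri o a x; omega)
        have := e _ _ hbb'
        have := tri b' b y
        have := sy b b'
        have := tri o b' y
        have := ih a b' ha (by omega) (by omega) (by omega)
        have := tri a o b'
        have := sy a o
        have := tri a b b'
        by_cases hj : G.dist o b' = 0
        · have hax : a = x := hG.1.dist_eq_zero_iff.mp (by omega)
          subst hax
          have := sy a b
          obtain ⟨w, hw1, hw2, hw⟩ := hB b a y (by omega) (by omega) hxy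
          have := e _ _ hw1
          have := tri o b w
          have := tri o w a
          have := sy w a
          exact hno w hw1 hw2 (by omega)
        · obtain ⟨b'', hbb'', hb''⟩ := hG.1.exists_adj_dist_add_one (o := o) (x := b') (by omega)
          have := e _ _ hbb''
          have := tri a o b''
          have := tri a b'' b'
          have := sy b' b''
          have := hA a b' b b'' (by omega) hbb'.symm hbb'' (by omega) (by omega)
          have := tri o b'' b
          have := sy b b''
          omega
  obtain ⟨X, hX0, hX1, hX2, hX3⟩ := hG.1.exists_geodesic o x
  obtain ⟨Y, hY0, hY1, hY2, hY3⟩ := hG.1.exists_geodesic o y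
  rw [hx] at hX1 hX2 hX3
  rw [hy] at hY1 hY2 hY3
  refine hG.false_of_odd_cycle hN X Y hX3 hY3 (hX0.trans hY0.symm) (by rw [hX1, hY1]; omega) ?_ ?_
  · intro i hi
    have h1 := hX2 i hi
    have h2 := hY2 (N - i) (by omega)
    exact key _ _ _ (by omega) (by omega) (Or.inl (by omega)) rfl
  · intro i hi hi'
    have h1 := hX2 i hi
    have h2 := hY2 (N + 1 - i) (by omega)
    exact key _ _ _ (by omega) (by omega) (Or.inr (by omega)) rfl

/-- Let `y` and `z` be nonadjacent neighbours of `x` that are closer to `o`. Then no neighbours of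
`y` and `z` that are closer to `o` still are equal or adjacent: they would form an induced
`4`-cycle or `5`-cycle with `x`, `y`, `z`. -/
lemma IsBridged.two_le_dist_of_not_neighborCondition (hG : G.IsBridged) {o x y z s t : V}
    (hxy : G.Adj x y) (hxz : G.Adj x z) (hyz : 2 ≤ G.dist y z)
    (hs : G.dist o s + 2 = G.dist o x) (ht : G.dist o t + 2 = G.dist o x) (hys : G.Adj y s)
    (hzt : G.Adj z t) : 2 ≤ G.dist s t := by
  by_contra hst
  have tri := fun a b c => hG.1.dist_triangle (u := a) (v := b) (w := c)
  have sy := fun a b => G.dist_comm (u := a) (v := b)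
  have hxs : 2 ≤ G.dist x s := by have := tri o s x; have := sy s x; omega
  have hxt : 2 ≤ G.dist x t := by have := tri o t x; have := sy t x; omega
  have hzs : ¬ G.Adj z s := fun h => hG.false_of_square hxy hys h.symm hxz.symm hxs hyz
  have hyt : ¬ G.Adj y t := fun h => hG.false_of_square hxy h hzt.symm hxz.symm hxt hyz
  have hne : s ≠ t := by rintro rfl; exact hyt hys
  have hyt2 : 2 ≤ G.dist y t := hG.1.one_lt_dist_of_ne_of_not_adj
    (by rintro rfl; have := dist_eq_one_iff_adj.mpr hzt; have := sy z y; omega) hyt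
  have hzs2 : 2 ≤ G.dist s z := by
    rw [G.dist_comm]
    exact hG.1.one_lt_dist_of_ne_of_not_adj
      (by rintro rfl; have := dist_eq_one_iff_adj.mpr hys; have := sy z y; omega) hzs
  exact hG.false_of_pentagon hxy hys (hG.1.adj_of_dist_le_one (by omega) hne) hzt.symm hxz.symm
    hxs hxt hyt2 hyz hzs2

/-- Let `y` and `z` be nonadjacent neighbours of `x` at distance `N - 1` from `o`, where `x` is at
distance `N`. The first vertex `b` of a geodesic from `o` to `z` is at distance `N` from `y`. -/
lemma IsBridged.le_dist_of_not_neighborCondition (hG : G.IsBridged) {N : ℕ} (hN : 3 ≤ N)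
    (hA : G.NeighborCondition (N - 1)) (hB : G.TriangleCondition (N - 1))
    (hB' : G.TriangleCondition (N - 2)) {o x y z b : V} (hx : G.dist o x = N) (hxy : G.Adj x y)
    (hxz : G.Adj x z) (hy : G.dist o y + 1 = N) (hz : G.dist o z + 1 = N)
    (hyz : 2 ≤ G.dist y z) (hb : G.dist o b = 1) (hbz : G.dist b z + 2 = N) :
    N ≤ G.dist y b := by
  have tri := fun a b c => hG.1.dist_triangle (u := a) (v := b) (w := c)
  have sy := fun a b => G.dist_comm (u := a) (v := b)
  have e := fun (a b : V) (h : G.Adj a b) => dist_eq_one_iff_adj.mpr h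
  by_contra hlt
  have hxy1 := e _ _ hxy
  have hxz1 := e _ _ hxz
  have := sy y x
  have := sy z x
  have hoy := sy o y
  obtain ⟨w, how, hwb, hyw⟩ : ∃ w, G.dist o w = 1 ∧ G.dist w b ≤ 1 ∧ G.dist y w + 2 = N := by
    have := tri o b y
    have := sy b y
    by_cases h : G.dist y b + 1 = N
    · obtain ⟨w, h1, h2, h3⟩ := hB y o b (by lia) (by lia) (dist_eq_one_iff_adj.mp hb)
      exact ⟨w, e _ _ h1, by rw [sy, e _ _ h2], by lia⟩
    · exact ⟨b, hb, by simp, by lia⟩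
  have hwx : G.dist w x + 1 = N := by
    have := tri o w x
    have := tri w y x
    have := sy w y
    lia
  have hwy := sy w y
  have hwz : G.dist w z + 1 = N := by
    have h1 := tri w b z
    have h2 := tri w z x
    by_contra h
    have := hA w x y z (by lia) hxy hxz (by lia) (by lia)
    lia
  obtain ⟨v, hxv, hzv, hwv⟩ := hB w x z (by lia) (by lia) hxz
  have hxv1 := e _ _ hxv
  have hzv1 := e _ _ hzv
  have hyv : G.Adj y v := by
    refine hG.1.adj_of_dist_le_one (hA w x y v (by lia) hxy hxv (by lia) (by lia)) ?_
    rintro rfl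
    have := sy z y
    lia
  have hov : G.dist o v + 1 = N := by
    have := tri o w v
    have := tri o v x
    have := sy x v
    lia
  obtain ⟨s, hys, hvs, hws⟩ := hB' w y v (by lia) (by lia) hyv
  have hos : G.dist o s + 2 = N := by
    have := tri o w s
    have := tri o s y
    have := sy s y
    have := e _ _ hys
    lia
  have hbv : G.dist b v + 2 = N := by
    have h1 := tri o b v
    have h2 := tri b z v
    by_contra h
    obtain ⟨b', hbb', hb'⟩ := hG.1.exists_adj_dist_add_one (o := z) (x := b)
      (by have := sy z b; lia)
    have := e _ _ hbb'
    have := sy z b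
    have := sy z b'
    have := sy v b
    have := sy v b'
    have := sy v w
    have := sy v z
    have := tri b' z v
    have := tri b b' v
    have hbw : G.Adj b w := by
      refine hG.1.adj_of_dist_le_one (by rw [sy]; lia) ?_
      rintro rfl
      lia
    have := hA v b w b' (by lia) hbw hbb' (by lia) (by lia)
    have := tri w b' z
    lia
  obtain ⟨t, hzt, hvt, hbt⟩ := hB' b z v (by lia) (by lia) hzv
  have hot : G.dist o t + 2 = N := by
    have := tri o b t
    have := tri o t z
    have := sy t z
    have := e _ _ hzt
    lia
  have h1 := hA o v s t (by lia) hvs hvt (by lia) (by lia)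
  have h2 := hG.two_le_dist_of_not_neighborCondition (o := o) (s := s) (t := t) hxy hxz hyz
    (by lia) (by lia) hys hzt
  lia

/-- Two nonadjacent neighbours `y`, `z` of `x` that are closer to `o` would span, with `x` and any
geodesics to `o`, an isometric cycle of length `2N`. -/
lemma IsBridged.neighborCondition_of_lt (hG : G.IsBridged) {N : ℕ} (hN : 2 ≤ N)
    (hA : G.NeighborCondition (N - 1)) (hB : G.TriangleCondition (N - 1))
    (hB' : G.TriangleCondition (N - 2)) : G.NeighborCondition N := by
  intro o x y z hx hxy hxz hy hz
  by_contra! hyz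
  have tri := fun a b c => hG.1.dist_triangle (u := a) (v := b) (w := c)
  have sy := fun a b => G.dist_comm (u := a) (v := b)
  have e := fun (a b : V) (h : G.Adj a b) => dist_eq_one_iff_adj.mpr h
  have hxy1 := e _ _ hxy
  have hxz1 := e _ _ hxz
  have := sy y x
  have := sy z x
  rcases hN.lt_or_eq with hN3 | rfl
  swap
  · have h1 : G.Adj y o := dist_eq_one_iff_adj.mp (by rw [sy]; lia)
    have h2 : G.Adj z o := dist_eq_one_iff_adj.mp (by rw [sy]; lia)
    have := hG.two_le_dist_of_not_neighborCondition (o := o) (s := o) (t := o) hxy hxz hyz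
      (by simp [hx]) (by simp [hx]) h1 h2
    simp at this
  -- The antipodal pairs `(a, b)` of the cycle, by induction on the distance from `a` to `y`.
  have key : ∀ m a b, G.dist o a + 1 + m = N → G.dist a y = m → G.dist o b = m + 1 →
      G.dist b z + m + 2 = N → N ≤ G.dist a b := by
    intro m
    induction m with
    | zero =>
      intro a b _ hay hb hbz
      have hay' : a = y := hG.1.dist_eq_zero_iff.mp hay
      subst hay'
      exact hG.le_dist_of_not_neighborCondition hN3 hA hB hB' hx hxy hxz hy hz hyz hb
        (by lia)
    | succ m ih =>
      intro a b ha hay hb hbz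
      by_contra hlt
      obtain ⟨a', haa', ha'⟩ := hG.1.exists_adj_dist_add_one (o := y) (x := a)
        (by have := sy a y; lia)
      obtain ⟨b', hbb', hb'⟩ := hG.1.exists_adj_dist_add_one (o := o) (x := b) (by lia)
      obtain ⟨b'', hbb'', hb''⟩ := hG.1.exists_adj_dist_add_one (o := o) (x := b') (by lia)
      have := e _ _ haa'
      have := e _ _ hbb'
      have := e _ _ hbb''
      have := sy a y
      have := sy a' y
      have := sy a o
      have := sy a' o
      have := sy a a'
      have := sy b b'
      have := sy b' b''
      have := tri o a a'
      have := tri o a' y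
      have := tri o b' z
      have := tri b' b z
      have := ih a' b' (by lia) (by lia) (by lia) (by lia)
      have := tri a' o b'
      have := tri a o b'
      have := tri a' a b'
      have := tri a b b'
      have := tri a o b''
      have := tri a b'' b'
      have := sy b'' b'
      have := tri o b'' b
      have := sy b'' b
      by_cases hab : G.dist a b + 2 = N
      · have := hA a b' b b'' (by lia) hbb'.symm hbb'' (by lia) (by lia)
        lia
      · -- `w` replaces `b'` on the geodesic through `b`, and is too close to `a'`.
        obtain ⟨w, hbw, hbw', haw⟩ := hB a b b' (by lia) (by lia) hbb'
        have := hA a b' w b'' (by lia) hbw' hbb'' (by lia) (by lia)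
        have := e _ _ hbw
        have := sy b w
        have := tri o w b
        have := tri o b'' w
        have := sy w b''
        have := tri w b z
        have := tri o w z
        have := ih a' w (by lia) (by lia) (by lia) (by lia)
        have := tri a' a w
        lia
  obtain ⟨Y, hY0, hY1, hY2, hY3⟩ := hG.1.exists_geodesic o y
  obtain ⟨Z, hZ0, hZ1, hZ2, hZ3⟩ := hG.1.exists_geodesic o z
  refine hG.false_of_even_cycle hN (fun k => if k < N then Y k else x)
    (fun k => if k < N then Z k else x) ?_ ?_ ?_ ?_ ?_
  · intro k hk
    by_cases h : k + 1 < N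
    · simp only [hk, h, if_true]; exact hY3 k (by lia)
    · simp only [hk, h, if_true, if_false]
      rw [show k = G.dist o y by lia, hY1]; lia
  · intro k hk
    by_cases h : k + 1 < N
    · simp only [hk, h, if_true]; exact hZ3 k (by lia)
    · simp only [hk, h, if_true, if_false]
      rw [show k = G.dist o z by lia, hZ1]; lia
  · simp [show 0 < N by lia, hY0, hZ0]
  · simp
  · intro i hi
    by_cases hi0 : i = 0
    · simp [hi0, show 0 < N by lia, hY0, hx]
    · by_cases hiN : i = N
      · simp [hiN, show 0 < N by lia, hZ0, sy x o, hx]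
      · have h1 := hY2 i (by lia)
        have h2 := hZ2 (N - i) (by lia)
        simp only [show i < N by lia, show N - i < N by lia, if_true]
        exact key (N - 1 - i) _ _ (by lia) (by lia) (by lia) (by lia)

theorem IsBridged.neighborCondition_and_triangleCondition (hG : G.IsBridged) (n : ℕ) :
    G.NeighborCondition n ∧ G.TriangleCondition n := by
  induction n using Nat.strong_induction_on with
  | _ n ih =>
    match n, ih with
    | 0, _ =>
      refine ⟨fun o x y z _ _ _ h => by omega, fun o x y hx hy hxy => ?_⟩
      rw [hG.1.dist_eq_zero_iff] at hx hy
      exact absurd (hx.symm.trans hy) hxy.ne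
    | 1, _ =>
      refine ⟨fun o x y z _ _ _ hy hz => ?_, fun o x y hx hy hxy => ?_⟩
      · rw [← hG.1.dist_eq_zero_iff.mp (show G.dist o y = 0 by omega),
          ← hG.1.dist_eq_zero_iff.mp (show G.dist o z = 0 by omega)]
        simp
      · exact ⟨o, (dist_eq_one_iff_adj.mp hx).symm, (dist_eq_one_iff_adj.mp hy).symm, by simp⟩
    | N + 2, ih =>
      have hA := hG.neighborCondition_of_lt (N := N + 2) (by omega) (ih (N + 1) (by omega)).1
        (ih (N + 1) (by omega)).2 (ih N (by omega)).2
      exact ⟨hA, hG.triangleCondition_of_lt (by omega) hA (ih (N + 1) (by omega)).2⟩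

lemma IsBridged.dist_le_one_of_closer (hG : G.IsBridged) {o x y z : V} (hxy : G.Adj x y)
    (hxz : G.Adj x z) (hy : G.dist o y + 1 = G.dist o x) (hz : G.dist o z + 1 = G.dist o x) :
    G.dist y z ≤ 1 :=
  (hG.neighborCondition_and_triangleCondition _).1 o x y z rfl hxy hxz hy hz

lemma IsBridged.exists_common_closer_neighbor (hG : G.IsBridged) {o x y : V} (hxy : G.Adj x y)
    (h : G.dist o y = G.dist o x) :
    ∃ w, G.Adj x w ∧ G.Adj y w ∧ G.dist o w + 1 = G.dist o x :=
  (hG.neighborCondition_and_triangleCondition _).2 o x y rfl h hxy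

/-- The vertices of a finite clique in a sphere around `o` have a common neighbour in the next
smaller sphere. -/
lemma IsBridged.exists_common_closer_neighbor_of_clique (hG : G.IsBridged) {o : V} {m : ℕ}
    (Q : Finset V) (hQ : Q.Nonempty) (hd : ∀ q ∈ Q, G.dist o q = m + 1)
    (hc : ∀ q ∈ Q, ∀ q' ∈ Q, G.dist q q' ≤ 1) :
    ∃ w, G.dist o w = m ∧ ∀ q ∈ Q, G.Adj q w := by
  classical
  induction hQ using Finset.Nonempty.cons_induction with
  | singleton a =>
    have ha := hd a (by simp)
    obtain ⟨w, h1, h2⟩ := hG.1.exists_adj_dist_add_one (o := o) (x := a) (by lia)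
    exact ⟨w, by lia, by simpa using h1⟩
  | cons q Q hq hQ ih =>
    obtain ⟨v, hv, hvQ⟩ := ih (fun q' h => hd q' (by simp [h]))
      (fun a ha b hb => hc a (by simp [ha]) b (by simp [hb]))
    by_cases hqv : G.Adj q v
    · exact ⟨v, hv, by simpa [hqv] using hvQ⟩
    obtain ⟨q₁, hq₁⟩ := hQ
    have hq0 := hd q (by simp)
    have hne : ∀ q' ∈ Q, q ≠ q' := by rintro q' h rfl; exact hq h
    have hadj : ∀ q' ∈ Q, G.Adj q q' := fun q' h =>
      hG.1.adj_of_dist_le_one (hc q (by simp) q' (by simp [h])) (hne q' h)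
    have hq10 := hd q₁ (by simp [hq₁])
    obtain ⟨w, hqw, hq₁w, hw⟩ := hG.exists_common_closer_neighbor (o := o) (hadj q₁ hq₁) (by lia)
    refine ⟨w, by lia, ?_⟩
    have hvw : G.Adj v w := by
      refine hG.1.adj_of_dist_le_one
        (hG.dist_le_one_of_closer (o := o) (hvQ q₁ hq₁) hq₁w (by lia) (by lia)) ?_
      rintro rfl
      exact hqv hqw
    intro q' hq'
    rcases Finset.mem_cons.mp hq' with rfl | hq'
    · exact hqw
    -- Otherwise `q`, `q'`, `v`, `w` is an induced `4`-cycle.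
    by_contra hcon
    have h0 := hd q' (by simp [hq'])
    refine hG.false_of_square (hadj q' hq') (hvQ q' hq') hvw hqw.symm ?_ ?_
    · exact hG.1.one_lt_dist_of_ne_of_not_adj (by rintro rfl; lia) hqv
    · exact hG.1.one_lt_dist_of_ne_of_not_adj (by rintro rfl; lia) hcon

/-! ### Levels of intervals -/

lemma IsBridged.mem_levelSet_succ (hG : G.IsBridged) {x o a w : V} {j : ℕ}
    (ha : a ∈ G.levelSet x o j) (haw : G.Adj a w) (hw : G.dist o w + 1 = G.dist o a) :
    w ∈ G.levelSet x o (j + 1) := by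
  obtain ⟨h1, h2⟩ := ha
  simp only [interval, Set.mem_ofPred_eq] at h1
  have := hG.1.dist_triangle (u := x) (v := a) (w := w)
  have := hG.1.dist_triangle (u := x) (v := w) (w := o)
  have := dist_eq_one_iff_adj.mpr haw
  have := G.dist_comm (u := o) (v := w)
  have := G.dist_comm (u := o) (v := a)
  exact ⟨by simp only [interval, Set.mem_ofPred_eq]; lia, by lia⟩

/-- A path in a level of an interval can be pushed down to the next level, at the cost of one more
step: successive vertices have common neighbours in the next level. -/
lemma IsBridged.exists_walk_level_succ (hG : G.IsBridged) {x o : V} {j : ℕ}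
    {u v : G.levelSet x o j} (p : (G.level x o j).Walk u v) (a b : G.levelSet x o (j + 1))
    (ha : G.Adj u.1 a.1) (hb : G.Adj v.1 b.1) :
    ∃ q : (G.level x o (j + 1)).Walk a b, q.length ≤ p.length + 1 := by
  have hlev : ∀ {i : ℕ} (z : G.levelSet x o i), i + G.dist o z.1 = G.dist x o := by
    rintro i ⟨z, h1, h2⟩
    simp only [interval, Set.mem_ofPred_eq] at h1
    rw [G.dist_comm (u := o)]
    simp only; omega
  have step : ∀ (c : G.levelSet x o j) (a b : G.levelSet x o (j + 1)), G.Adj c.1 a.1 →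
      G.Adj c.1 b.1 → ∃ q : (G.level x o (j + 1)).Walk a b, q.length ≤ 1 := by
    intro c a b hca hcb
    have h1 := hlev c
    have h2 := hlev a
    have h3 := hlev b
    by_cases hab : a = b
    · subst hab
      exact ⟨Walk.nil, by simp⟩
    · have : (G.level x o (j + 1)).Adj a b :=
        hG.1.adj_of_dist_le_one
          (hG.dist_le_one_of_closer (o := o) (x := c.1) (y := a.1) (z := b.1) hca hcb
            (by omega) (by omega))
          (fun h => hab (Subtype.ext h))
      exact ⟨this.toWalk, by simp⟩
  induction p generalizing a with
  | nil =>
    obtain ⟨q, hq⟩ := step _ a b ha hb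
    exact ⟨q, by simpa using hq⟩
  | @cons u w v h p ih =>
    have h' : G.Adj u.1 w.1 := h
    have h1 := hlev u
    have h2 := hlev w
    obtain ⟨c, huc, hwc, hc⟩ := hG.exists_common_closer_neighbor (o := o) h' (by lia)
    have hcl := hG.mem_levelSet_succ u.2 huc hc
    obtain ⟨q₁, hq₁⟩ := step u a ⟨c, hcl⟩ ha huc
    obtain ⟨q₂, hq₂⟩ := ih ⟨c, hcl⟩ hwc hb
    exact ⟨q₁.append q₂, by rw [Walk.length_append, Walk.length_cons]; lia⟩

/-- The `j`-level of an interval is connected and has diameter at most `j` in its own metric. -/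
lemma IsBridged.exists_walk_level (hG : G.IsBridged) {x o : V} (j : ℕ)
    (a b : G.levelSet x o j) : ∃ q : (G.level x o j).Walk a b, q.length ≤ j := by
  induction j with
  | zero =>
    have h : ∀ z : G.levelSet x o 0, z.1 = x := fun z => (hG.1.dist_eq_zero_iff.mp z.2.2).symm
    have hab : a = b := Subtype.ext ((h a).trans (h b).symm)
    subst hab
    exact ⟨Walk.nil, by simp⟩
  | succ j ih =>
    have hup : ∀ z : G.levelSet x o (j + 1), ∃ u : G.levelSet x o j, G.Adj u.1 z.1 := by
      rintro ⟨z, h1, h2⟩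
      simp only [interval, Set.mem_ofPred_eq] at h1
      obtain ⟨w, hzw, hw⟩ := hG.1.exists_adj_dist_add_one (o := x) (x := z) (by lia)
      have := hG.1.dist_triangle (u := x) (v := w) (w := o)
      have := hG.1.dist_triangle (u := w) (v := z) (w := o)
      have := dist_eq_one_iff_adj.mpr hzw.symm
      exact ⟨⟨w, by simp only [interval, Set.mem_ofPred_eq]; lia, by lia⟩, hzw.symm⟩
    obtain ⟨u, hu⟩ := hup a
    obtain ⟨v, hv⟩ := hup b
    obtain ⟨p, hp⟩ := ih u v
    obtain ⟨q, hq⟩ := hG.exists_walk_level_succ p a b hu hv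
    exact ⟨q, hq.trans (by lia)⟩

/-! ### A contraction towards a base point -/

lemma mem_interval_trans (hG : G.Connected) {o y z w : V} (hz : z ∈ G.interval y o)
    (hw : w ∈ G.interval z o) : w ∈ G.interval y o := by
  simp only [interval, Set.mem_ofPred_eq] at *
  have := hG.dist_triangle (u := y) (v := z) (w := w)
  have := hG.dist_triangle (u := y) (v := w) (w := o)
  lia

/-- Choose for each vertex `y` a common neighbour of all neighbours of `y` that are closer to `o`,
two steps closer to `o` than `y` is. This is a `1`-Lipschitz map, and its value at `y` lies in the
interval between `o` and each vertex of the `1`-ball around `y`. -/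
lemma IsBridged.exists_contraction (hG : G.IsBridged) (hfin : ∀ v, (G.neighborSet v).Finite)
    (o : V) : ∃ p : V → V, (∀ y, G.dist o (p y) = G.dist o y - 2) ∧
      (∀ y y', G.Adj y y' → G.dist (p y) (p y') ≤ 1) ∧
      ∀ y y', G.dist y y' ≤ 1 → p y ∈ G.interval y' o := by
  have e := fun (a b : V) (h : G.Adj a b) => dist_eq_one_iff_adj.mpr h
  have tri := fun a b c => hG.1.dist_triangle (u := a) (v := b) (w := c)
  have sy := fun a b => G.dist_comm (u := a) (v := b)
  have hex : ∀ y, ∃ c, G.dist o c = G.dist o y - 2 ∧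
      (2 ≤ G.dist o y → ∀ q, G.Adj y q → G.dist o q + 1 = G.dist o y → G.Adj q c) := by
    intro y
    by_cases h : 2 ≤ G.dist o y
    · have hQ : {q | G.Adj y q ∧ G.dist o q + 1 = G.dist o y}.Finite :=
        (hfin y).subset fun q hq => hq.1
      obtain ⟨w, hw, hadj⟩ := hG.exists_common_closer_neighbor_of_clique (o := o)
        (m := G.dist o y - 2) hQ.toFinset
        (by
          obtain ⟨w, h1, h2⟩ := hG.1.exists_adj_dist_add_one (o := o) (x := y) (by lia)
          exact ⟨w, by simp [h1, h2]⟩)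
        (by
          intro q hq
          simp only [Set.Finite.mem_toFinset, Set.mem_ofPred_eq] at hq
          lia)
        (by
          intro q hq q' hq'
          simp only [Set.Finite.mem_toFinset, Set.mem_ofPred_eq] at hq hq'
          exact hG.dist_le_one_of_closer hq.1 hq'.1 hq.2 hq'.2)
      exact ⟨w, hw, fun _ q h1 h2 => hadj q (by simp [h1, h2])⟩
    · exact ⟨o, by simp; lia, fun h' => absurd h' h⟩
  choose p hp hpq using hex
  have hsame : ∀ y y', G.Adj y y' → G.dist o y' = G.dist o y → 2 ≤ G.dist o y →
      ∃ q, G.dist o q + 1 = G.dist o y ∧ G.Adj q (p y) ∧ G.Adj q (p y') ∧ G.Adj y' q := by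
    intro y y' h h1 h2
    obtain ⟨q, hq1, hq2, hq⟩ := hG.exists_common_closer_neighbor h h1
    exact ⟨q, hq, hpq y h2 q hq1 hq, hpq y' (by lia) q hq2 (by lia), hq2⟩
  have hdown : ∀ y y', G.Adj y y' → G.dist o y' + 1 = G.dist o y → G.dist (p y) (p y') ≤ 1 := by
    intro y y' h h1
    have h2 := hp y
    have h3 := hp y'
    by_cases hy' : 2 ≤ G.dist o y'
    · have := hpq y' hy' (p y) (hpq y (by lia) y' h h1) (by lia)
      rw [e _ _ this]
    · rw [← hG.1.dist_eq_zero_iff.mp (show G.dist o (p y') = 0 by lia), sy]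
      lia
  refine ⟨p, hp, ?_, ?_⟩
  · intro y y' h
    have h1 := tri o y y'
    have h2 := tri o y' y
    have h3 := e _ _ h
    have h4 := sy y y'
    have h5 := hp y
    have h6 := hp y'
    rcases lt_trichotomy (G.dist o y') (G.dist o y) with hlt | heq | hlt
    · exact hdown y y' h (by lia)
    · by_cases hy : 2 ≤ G.dist o y
      · obtain ⟨q, hq, hq1, hq2, -⟩ := hsame y y' h heq hy
        exact hG.dist_le_one_of_closer (o := o) hq1 hq2 (by lia) (by lia)
      · have := tri (p y) o (p y')
        have := sy o (p y)
        lia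
    · rw [sy]
      exact hdown y' y h.symm (by lia)
  · intro y y' h
    have h1 := tri o y y'
    have h2 := tri o y' y
    have h4 := sy y y'
    have h5 := hp y
    have h6 := sy o (p y)
    have h7 := tri y' (p y) o
    have h8 := sy o y'
    simp only [interval, Set.mem_ofPred_eq]
    by_cases hy : 2 ≤ G.dist o y
    · obtain ⟨q, hq1, hq⟩ := hG.1.exists_adj_dist_add_one (o := o) (x := y) (by lia)
      have h9 := e _ _ (hpq y hy q hq1 hq)
      have h10 := e _ _ hq1
      have h11 := tri y q (p y)
      have h12 := tri y' y (p y)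
      by_cases hyy : y = y'
      · subst hyy
        lia
      have hadj := hG.1.adj_of_dist_le_one h hyy
      rcases lt_trichotomy (G.dist o y') (G.dist o y) with hlt | heq | hlt
      · have := e _ _ (hpq y hy y' hadj (by lia))
        lia
      · obtain ⟨q, hq, hq1, -, hq2⟩ := hsame y y' hadj heq hy
        have := e _ _ hq1
        have := e _ _ hq2
        have := tri y' q (p y)
        lia
      · lia
    · have h9 := hG.1.dist_eq_zero_iff.mp (show G.dist o (p y) = 0 by lia)
      rw [← h9]
      simp

/-- For each `n`, some vertex within `3n` of all vertices of the `n`-ball around `x` lies on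
geodesics from all of them to `o`. -/
lemma IsBridged.exists_mem_interval_of_ball (hG : G.IsBridged)
    (hfin : ∀ v, (G.neighborSet v).Finite) (o x : V) (n : ℕ) :
    ∃ z, ∀ y, G.dist x y ≤ n → z ∈ G.interval y o ∧ G.dist y z ≤ 3 * n := by
  obtain ⟨p, hp, hlip, hint⟩ := hG.exists_contraction hfin o
  have tri := fun a b c => hG.1.dist_triangle (u := a) (v := b) (w := c)
  have hd : ∀ n x, G.dist o (p^[n] x) = G.dist o x - 2 * n := by
    intro n
    induction n with
    | zero => simp
    | succ n ih =>
      intro x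
      rw [Function.iterate_succ_apply, ih, hp]
      lia
  have hlip' : ∀ {a b : V} (w : G.Walk a b), G.dist (p a) (p b) ≤ w.length := by
    intro a b w
    induction w with
    | nil => simp
    | @cons u v w h q ih =>
      have := hlip u v h
      have := tri (p u) (p v) (p w)
      rw [Walk.length_cons]
      lia
  have hmem : ∀ n x y, G.dist x y ≤ n → p^[n] x ∈ G.interval y o := by
    intro n
    induction n with
    | zero =>
      intro x y h
      rw [hG.1.dist_eq_zero_iff.mp (show G.dist x y = 0 by lia)]
      simp [interval]
    | succ n ih =>
      intro x y h
      obtain ⟨z, hxz, hzy⟩ : ∃ z, G.dist x z ≤ n ∧ G.dist z y ≤ 1 := by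
        by_cases h0 : G.dist x y = 0
        · exact ⟨y, by lia, by simp⟩
        · obtain ⟨z, h1, h2⟩ := hG.1.exists_adj_dist_add_one (o := x) (x := y) (by lia)
          exact ⟨z, by lia, by rw [G.dist_comm, dist_eq_one_iff_adj.mpr h1]⟩
      obtain ⟨w, hw⟩ := hG.1.exists_walk_length_eq_dist x z
      have := hlip' w
      rw [Function.iterate_succ_apply]
      exact mem_interval_trans hG.1 (hint z y hzy) (ih (p x) (p z) (by lia))
  refine ⟨p^[n] x, fun y hy => ⟨hmem n x y hy, ?_⟩⟩
  have h1 := hmem n x y hy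
  simp only [interval, Set.mem_ofPred_eq] at h1
  have h2 := hd n x
  have h3 := tri o x y
  have h4 := G.dist_comm (u := y) (v := o)
  have h5 := G.dist_comm (u := p^[n] x) (v := o)
  lia

/-! ### The size of intervals -/

lemma Connected.exists_finset_ball (hG : G.Connected) {D : ℕ}
    (hdeg : ∀ v, ∃ s : Finset V, s.card ≤ D ∧ ∀ w, G.Adj v w → w ∈ s) (v : V) (r : ℕ) :
    ∃ s : Finset V, s.card ≤ (D + 1) ^ r ∧ ∀ w, G.dist v w ≤ r → w ∈ s := by
  classical
  induction r with
  | zero =>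
    refine ⟨{v}, by simp, fun w h => ?_⟩
    simp [hG.dist_eq_zero_iff.mp (show G.dist v w = 0 by omega)]
  | succ r ih =>
    obtain ⟨s, hs, hmem⟩ := ih
    choose nb hnb hnbm using hdeg
    refine ⟨s.biUnion fun u => insert u (nb u), ?_, fun w h => ?_⟩
    · refine (Finset.card_biUnion_le_card_mul _ _ (D + 1) fun u _ => ?_).trans ?_
      · exact (Finset.card_insert_le _ _).trans (by have := hnb u; omega)
      · rw [pow_succ]
        exact Nat.mul_le_mul_right _ hs
    · rw [Finset.mem_biUnion]
      by_cases h0 : G.dist v w = 0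
      · exact ⟨w, hmem w (by omega), by simp⟩
      · obtain ⟨u, h1, h2⟩ := hG.exists_adj_dist_add_one (o := v) (x := w) (by omega)
        exact ⟨u, hmem u (by omega), by simp [hnbm u w h1.symm]⟩

lemma pathGraph_le_add_dist {n : ℕ} (a b : Fin (n + 1)) :
    a.val ≤ b.val + (pathGraph (n + 1)).dist a b := by
  obtain ⟨p, hp⟩ := (pathGraph_connected n).exists_walk_length_eq_dist a b
  rw [← hp]
  clear hp
  induction p with
  | nil => simp
  | cons h p ih =>
    rw [pathGraph_adj] at h
    rw [Walk.length_cons]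
    omega

/-- A level at distance `j` has at most linearly many vertices in `j`: its image in the segment has
linear diameter, and the fibres have bounded diameter. -/
lemma IsBridged.card_le_of_subset_levelSet (hG : G.IsBridged) {D : ℕ}
    (hdeg : ∀ v, ∃ s : Finset V, s.card ≤ D ∧ ∀ w, G.Adj v w → w ∈ s) {B C : ℝ} (hB : 0 < B)
    {x o : V} {j : ℕ} (hq : (G.level x o j).IsQuasiSegment B C) (T : Finset V)
    (hT : ∀ z ∈ T, z ∈ G.levelSet x o j) :
    T.card ≤ (D + 1) ^ ⌊B * C⌋₊ * (2 * ⌊B * j + C⌋₊ + 1) := by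
  classical
  obtain ⟨m, f, -, hf⟩ := hq
  let g : V → ℕ := fun z => if h : z ∈ G.levelSet x o j then (f ⟨z, h⟩).val else 0
  have hg : ∀ z (h : z ∈ G.levelSet x o j), g z = (f ⟨z, h⟩).val := fun z h => dif_pos h
  have hdist : ∀ a b : G.levelSet x o j, (G.level x o j).dist a b ≤ j := by
    intro a b
    obtain ⟨q, hq⟩ := hG.exists_walk_level j a b
    exact (dist_le q).trans hq
  have himage : (T.image g).card ≤ 2 * ⌊B * j + C⌋₊ + 1 := by
    rcases T.eq_empty_or_nonempty with rfl | ⟨z₀, hz₀⟩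
    · simp
    have hsub : T.image g ⊆ Finset.Icc (g z₀ - ⌊B * j + C⌋₊) (g z₀ + ⌊B * j + C⌋₊) := by
      intro i hi
      obtain ⟨z, hz, rfl⟩ := Finset.mem_image.mp hi
      have h1 := (hf ⟨z, hT z hz⟩ ⟨z₀, hT z₀ hz₀⟩).2
      have h2 : ((G.level x o j).dist ⟨z, hT z hz⟩ ⟨z₀, hT z₀ hz₀⟩ : ℝ) ≤ j := by
        exact_mod_cast hdist _ _
      have h3 := Nat.le_floor (h1.trans (add_le_add_left (mul_le_mul_of_nonneg_left h2 hB.le) C))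
      have h4 := pathGraph_le_add_dist (f ⟨z, hT z hz⟩) (f ⟨z₀, hT z₀ hz₀⟩)
      have h5 := pathGraph_le_add_dist (f ⟨z₀, hT z₀ hz₀⟩) (f ⟨z, hT z hz⟩)
      rw [dist_comm] at h5
      rw [Finset.mem_Icc, hg z (hT z hz), hg z₀ (hT z₀ hz₀)]
      omega
    have := Finset.card_le_card hsub
    rw [Nat.card_Icc] at this
    omega
  refine (Finset.card_le_mul_card_image T _ fun i hi => ?_).trans
    (Nat.mul_le_mul_left _ himage)
  obtain ⟨z, hz, rfl⟩ := Finset.mem_image.mp hi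
  obtain ⟨s, hs, hball⟩ := hG.1.exists_finset_ball hdeg z ⌊B * C⌋₊
  refine (Finset.card_le_card fun w hw => ?_).trans hs
  obtain ⟨hw, hwz⟩ := Finset.mem_filter.mp hw
  refine hball w ?_
  rw [hg w (hT w hw), hg z (hT z hz)] at hwz
  have h1 := (hf ⟨z, hT z hz⟩ ⟨w, hT w hw⟩).1
  rw [Fin.ext hwz, dist_self, Nat.cast_zero, sub_nonpos, inv_mul_le_iff₀ hB] at h1
  refine le_trans ?_ (Nat.le_floor h1)
  obtain ⟨q, -⟩ := hG.exists_walk_level j ⟨z, hT z hz⟩ ⟨w, hT w hw⟩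
  obtain ⟨p, hp⟩ := q.reachable.exists_walk_length_eq_dist
  have h2 := dist_le (p.map (⟨Subtype.val, fun h => h⟩ : G.level x o j →g G))
  rw [Walk.length_map, hp] at h2
  exact h2

lemma IsBridged.card_le_of_subset_interval (hG : G.IsBridged) {D : ℕ}
    (hdeg : ∀ v, ∃ s : Finset V, s.card ≤ D ∧ ∀ w, G.Adj v w → w ∈ s) {B C : ℝ} (hB : 0 < B)
    (hq : ∀ u v k, k ≤ G.dist u v → (G.level u v k).IsQuasiSegment B C)
    {x o : V} {L : ℕ} (T : Finset V) (hT : ∀ z ∈ T, z ∈ G.interval x o ∧ G.dist x z ≤ L) :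
    T.card ≤ (D + 1) ^ ⌊B * C⌋₊ * (2 * ⌊B * L + C⌋₊ + 1) * (L + 1) := by
  have himage : (T.image (G.dist x)).card ≤ L + 1 := by
    refine (Finset.card_le_card (t := Finset.range (L + 1)) fun i hi => ?_).trans (by simp)
    obtain ⟨z, hz, rfl⟩ := Finset.mem_image.mp hi
    have := (hT z hz).2
    rw [Finset.mem_range]
    omega
  refine (Finset.card_le_mul_card_image T _ fun i hi => ?_).trans
    (Nat.mul_le_mul_left _ himage)
  obtain ⟨z, hz, rfl⟩ := Finset.mem_image.mp hi
  obtain ⟨hz1, hz2⟩ := hT z hz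
  have hz3 : G.dist x z ≤ G.dist x o := by
    simp only [interval, Set.mem_ofPred_eq] at hz1
    omega
  refine (hG.card_le_of_subset_levelSet hdeg hB (hq x o _ hz3) _ fun w hw => ?_).trans ?_
  · obtain ⟨hw, hwz⟩ := Finset.mem_filter.mp hw
    exact ⟨(hT w hw).1, hwz⟩
  · have : (G.dist x z : ℝ) ≤ L := by exact_mod_cast hz2
    gcongr

end SimpleGraph

/-! ### A criterion for Property A -/

lemma sum_range_sub_add_le {b : ℕ → ℝ} (hb : Antitone b) (h0 : ∀ i, 0 ≤ b i) (m s : ℕ) :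
    ∑ i ∈ Finset.range m, (b i - b (i + s)) ≤ s * b 0 := by
  induction s with
  | zero => simp
  | succ s ih =>
    have h1 : ∑ i ∈ Finset.range m, (b i - b (i + (s + 1))) =
        ∑ i ∈ Finset.range m, (b i - b (i + s)) + (b s - b (m + s)) := by
      have := Finset.sum_range_sub' (fun i => b (i + s)) m
      rw [zero_add] at this
      rw [← this, ← Finset.sum_add_distrib]
      refine Finset.sum_congr rfl fun i _ => ?_
      rw [show i + (s + 1) = i + 1 + s by ring]
      ring
    have h2 : b s ≤ b 0 := hb (Nat.zero_le s)
    have h3 := h0 (m + s)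
    rw [h1]
    push_cast
    linarith

/-- The ratios `a (i + s) / a i` of a decreasing sequence in `[1, K]` are close to `1` on average,
since the absolute values of their logarithms add up to at most `s * log K`. -/
lemma le_sum_range_div {a : ℕ → ℕ} (ha : Antitone a) {K n : ℕ} (hK : a 0 ≤ K) {m s : ℕ}
    (hpos : ∀ i < n, 0 < a i) (hn : m + s ≤ n) :
    (m : ℝ) - s * Real.log K ≤ ∑ i ∈ Finset.range m, (a (i + s) : ℝ) / a i := by
  have hb : Antitone fun i => Real.log (a i) := by
    intro i j hij
    rcases Nat.eq_zero_or_pos (a j) with h | h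
    · simp [h, Real.log_natCast_nonneg]
    · exact Real.log_le_log (by exact_mod_cast h) (by exact_mod_cast ha hij)
  have h1 := sum_range_sub_add_le hb (fun i => Real.log_natCast_nonneg _) m s
  have h2 : Real.log (a 0) ≤ Real.log K := by
    rcases Nat.eq_zero_or_pos (a 0) with h | h
    · simp [h, Real.log_natCast_nonneg]
    · exact Real.log_le_log (by exact_mod_cast h) (by exact_mod_cast hK)
  have h3 : (m : ℝ) - ∑ i ∈ Finset.range m, (Real.log (a i) - Real.log (a (i + s))) ≤
      ∑ i ∈ Finset.range m, (a (i + s) : ℝ) / a i := by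
    have : (m : ℝ) = ∑ i ∈ Finset.range m, (1 : ℝ) := by simp
    rw [this, ← Finset.sum_sub_distrib]
    refine Finset.sum_le_sum fun i hi => ?_
    rw [Finset.mem_range] at hi
    have hi1 : (0 : ℝ) < a i := by exact_mod_cast hpos i (by omega)
    have hi2 : (0 : ℝ) < a (i + s) := by exact_mod_cast hpos (i + s) (by omega)
    have := Real.log_le_sub_one_of_pos (div_pos hi2 hi1)
    rw [Real.log_div hi2.ne' hi1.ne'] at this
    linarith
  have h4 : (s : ℝ) * Real.log (a 0) ≤ s * Real.log K := by gcongr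
  linarith

/-- Property A follows from families of decreasing finite sets `F x 0 ⊇ F x 1 ⊇ ⋯` that are
shifted by at most `R` when `x` moves by `R`, provided that the sets have subexponential size
in the number `2n` of steps for which they remain nonempty. The sets `A x` average the normalized
counting measures of `F x 0, …, F x (n - 1)`: they contain each point of `F x k` with multiplicity
`M / |F x k|`, where `M` is a common multiple of all cardinalities. -/
theorem hasPropertyA_of_decreasing {X : Type*} [MetricSpace X] (hX : IsUniformlyDiscreteSpace X)
    (K : ℕ → ℕ) (hK : Filter.Tendsto (fun n : ℕ => Real.log (K n) / n) Filter.atTop (nhds 0))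
    (h : ∀ n : ℕ, ∃ (F : X → ℕ → Finset X) (S : ℝ),
      (∀ (x y : X) (k R : ℕ), dist x y ≤ R → F x (k + R) ⊆ F y k) ∧
      (∀ x, ∀ k ≤ 2 * n, (F x k).Nonempty) ∧ (∀ x, (F x 0).card ≤ K n) ∧
      ∀ x, ∀ z ∈ F x 0, dist z x ≤ S) : HasPropertyA X := by
  classical
  refine ⟨hX, fun ε R hε hR => ?_⟩
  obtain ⟨r, hr⟩ := exists_nat_ge R
  have hδ : 0 < ε / (2 + ε) := by positivity
  have hlim : Filter.Tendsto (fun n : ℕ => (r : ℝ) / n + 2 * r * (Real.log (K n) / n))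
      Filter.atTop (nhds 0) := by
    simpa using (tendsto_const_div_atTop_nhds_zero_nat (r : ℝ)).add (hK.const_mul (2 * r : ℝ))
  obtain ⟨n, hn, hn1, hnr⟩ := ((hlim.eventually_lt_const hδ).and
    ((Filter.eventually_ge_atTop 1).and (Filter.eventually_ge_atTop r))).exists
  have hn0 : (0 : ℝ) < n := by exact_mod_cast hn1
  have hn' : r + 2 * r * Real.log (K n) ≤ ε / (2 + ε) * n := by
    have := mul_le_mul_of_nonneg_right hn.le hn0.le
    rwa [add_mul, div_mul_cancel₀ _ hn0.ne', mul_assoc (2 * (r : ℝ)),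
      div_mul_cancel₀ _ hn0.ne'] at this
  obtain ⟨F, S, hF, hne, hcard, hS⟩ := h n
  have hanti : ∀ x, Antitone (F x) := by
    intro x i j hij
    have := hF x x i (j - i) (by simp)
    rwa [Nat.add_sub_cancel' hij] at this
  have hcard' : ∀ x k, (F x k).card ≤ K n := fun x k =>
    (Finset.card_le_card (hanti x (Nat.zero_le k))).trans (hcard x)
  let M : ℕ := (K n).factorial
  have hdvd : ∀ x, ∀ k ≤ 2 * n, (F x k).card ∣ M := fun x k hk =>
    Nat.dvd_factorial (hne x k hk).card_pos (hcard' x k)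
  let P : X → Finset (Σ _ : ℕ, X × ℕ) := fun x =>
    (Finset.range n).sigma fun k => F x k ×ˢ Finset.range (M / (F x k).card)
  let e : (Σ _ : ℕ, X × ℕ) ↪ X × ℕ := ⟨fun q => (q.2.1, Nat.pair q.1 q.2.2), by
    rintro ⟨k, z, t⟩ ⟨k', z', t'⟩ hq
    simp only [Prod.mk.injEq, Nat.pair_eq_pair] at hq
    obtain ⟨rfl, rfl, rfl⟩ := hq
    rfl⟩
  have hP : ∀ x, (P x).card = n * M := by
    intro x
    rw [Finset.card_sigma, Finset.sum_congr rfl (g := fun _ => M), Finset.sum_const,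
      Finset.card_range, smul_eq_mul]
    intro k hk
    rw [Finset.card_product, Finset.card_range]
    exact Nat.mul_div_cancel' (hdvd x k (by have := Finset.mem_range.mp hk; omega))
  refine ⟨fun x => (P x).map e, max S 1, by positivity, fun x y hxy => ?_, fun x p hp => ?_⟩
  swap
  · obtain ⟨⟨k, z, t⟩, hq, rfl⟩ := Finset.mem_map.mp hp
    obtain ⟨-, hq⟩ := Finset.mem_sigma.mp hq
    obtain ⟨hz, -⟩ := Finset.mem_product.mp hq
    exact (hS x z (hanti x (Nat.zero_le k) hz)).trans (le_max_left _ _)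
  have hxr : dist x y ≤ r := hxy.trans hr
  have hyr : dist y x ≤ r := by rwa [dist_comm]
  let Q : Finset (Σ _ : ℕ, X × ℕ) := (Finset.Ico r n).sigma fun k =>
    F x (k + r) ×ˢ Finset.range (M / (F x (k - r)).card)
  have hQ : Q ⊆ P x ∩ P y := by
    rintro ⟨k, z, t⟩ hq
    obtain ⟨hk, hq⟩ := Finset.mem_sigma.mp hq
    obtain ⟨hz, ht⟩ := Finset.mem_product.mp hq
    simp only [Finset.mem_Ico, Finset.mem_range] at hk hz ht
    have hpos : ∀ x', 0 < (F x' k).card := fun x' => (hne x' k (by omega)).card_pos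
    have hsub : ∀ x', dist x' x ≤ r → (F x' k).card ≤ (F x (k - r)).card := by
      intro x' hx'
      have := hF x' x (k - r) r hx'
      rw [Nat.sub_add_cancel hk.1] at this
      exact Finset.card_le_card this
    have hmem : ∀ x', dist x x' ≤ r → dist x' x ≤ r → (⟨k, z, t⟩ : Σ _ : ℕ, X × ℕ) ∈ P x' := by
      intro x' h1 h2
      refine Finset.mem_sigma.mpr ⟨Finset.mem_range.mpr hk.2, Finset.mem_product.mpr
        ⟨hF x x' k r h1 hz, Finset.mem_range.mpr (ht.trans_le ?_)⟩⟩
      exact Nat.div_le_div_left (hsub x' h2) (hpos x')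
    exact Finset.mem_inter.mpr ⟨hmem x (by simp) (by simp), hmem y hxr hyr⟩
  have hM : (0 : ℝ) < M := by exact_mod_cast Nat.factorial_pos _
  have hQcard : (M : ℝ) * (n - r - 2 * r * Real.log (K n)) ≤ Q.card := by
    have h1 : (Q.card : ℝ) = M * ∑ i ∈ Finset.range (n - r),
        ((F x (i + 2 * r)).card : ℝ) / (F x i).card := by
      rw [Finset.card_sigma, Finset.sum_Ico_eq_sum_range, Nat.cast_sum, Finset.mul_sum]
      refine Finset.sum_congr rfl fun i hi => ?_
      rw [Finset.mem_range] at hi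
      have h0 : ((F x i).card : ℝ) ≠ 0 := by exact_mod_cast (hne x i (by omega)).card_pos.ne'
      rw [Finset.card_product, Finset.card_range, Nat.add_sub_cancel_left, Nat.cast_mul,
        Nat.cast_div (hdvd x i (by omega)) h0, show r + i + r = i + 2 * r by ring]
      ring
    have h2 := le_sum_range_div (a := fun i => (F x i).card)
      (fun i j hij => Finset.card_le_card (hanti x hij)) (hcard x) (m := n - r) (s := 2 * r)
      (n := n + r) (fun i hi => (hne x i (by omega)).card_pos) (by omega)
    rw [Nat.cast_sub hnr] at h2
    push_cast at h2
    rw [h1]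
    gcongr
  have hI : (M : ℝ) * (n - r - 2 * r * Real.log (K n)) ≤ ((P x ∩ P y).card : ℝ) :=
    hQcard.trans (by exact_mod_cast Finset.card_le_card hQ)
  have hI' : (n * M : ℝ) * (2 / (2 + ε)) ≤ ((P x ∩ P y).card : ℝ) := by
    have h1 : (2 / (2 + ε)) = 1 - ε / (2 + ε) := by
      have : (2 + ε) ≠ 0 := by positivity
      field_simp
      ring
    refine le_trans ?_ hI
    rw [h1, mul_comm (n : ℝ), mul_assoc]
    refine mul_le_mul_of_nonneg_left ?_ hM.le
    linarith
  have hIpos : (0 : ℝ) < (P x ∩ P y).card := lt_of_lt_of_le (by positivity) hI'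
  rw [← Finset.map_inter, Finset.card_map]
  refine ⟨?_, ?_⟩
  · rw [Finset.map_nonempty, ← Finset.card_pos]
    exact_mod_cast hIpos
  · rw [div_le_iff₀ hIpos]
    have h1 := Finset.card_sdiff_add_card_inter (P x) (P y)
    have h2 := Finset.card_sdiff_add_card_inter (P y) (P x)
    rw [hP] at h1 h2
    rw [Finset.inter_comm] at h2
    have h3 : (symmDiff ((P x).map e) ((P y).map e)).card ≤
        (P x \ P y).card + (P y \ P x).card := by
      rw [symmDiff, Finset.sup_eq_union, ← Finset.map_sdiff, ← Finset.map_sdiff]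
      exact (Finset.card_union_le _ _).trans (by simp)
    have h4 : ((symmDiff ((P x).map e) ((P y).map e)).card : ℝ) + 2 * (P x ∩ P y).card ≤
        2 * (n * M) := by
      exact_mod_cast (by omega : (symmDiff ((P x).map e) ((P y).map e)).card +
        2 * (P x ∩ P y).card ≤ 2 * (n * M))
    rw [← mul_div_assoc, div_le_iff₀ (by positivity)] at hI'
    linarith

/-! ### Systolic complexes -/

lemma tendsto_log_div_of_le_sq (K : ℕ → ℕ) (c : ℝ) (h : ∀ n : ℕ, 1 ≤ n → (K n : ℝ) ≤ c * n ^ 2) :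
    Filter.Tendsto (fun n : ℕ => Real.log (K n) / n) Filter.atTop (nhds 0) := by
  have h1 : Filter.Tendsto (fun n : ℕ => Real.log n / n) Filter.atTop (nhds 0) :=
    Real.isLittleO_log_id_atTop.tendsto_div_nhds_zero.comp tendsto_natCast_atTop_atTop
  have h2 : Filter.Tendsto (fun n : ℕ => |Real.log c| / n + 2 * (Real.log n / n))
      Filter.atTop (nhds 0) := by
    simpa using (tendsto_const_div_atTop_nhds_zero_nat |Real.log c|).add (h1.const_mul 2)
  refine tendsto_of_tendsto_of_tendsto_of_le_of_le' tendsto_const_nhds h2 ?_ ?_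
  · exact Filter.Eventually.of_forall fun n =>
      div_nonneg (Real.log_natCast_nonneg _) (Nat.cast_nonneg n)
  · filter_upwards [Filter.eventually_ge_atTop 1] with n hn
    have hn0 : (0 : ℝ) < n := by exact_mod_cast hn
    have h3 : Real.log (K n) ≤ |Real.log c| + 2 * Real.log n := by
      rcases Nat.eq_zero_or_pos (K n) with h0 | h0
      · have := Real.log_natCast_nonneg n
        rw [h0, Nat.cast_zero, Real.log_zero]
        positivity
      · have hK : (0 : ℝ) < K n := by exact_mod_cast h0
        have hc : 0 < c := by
          by_contra hc
          have := h n hn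
          nlinarith [sq_nonneg (n : ℝ)]
        have := Real.log_le_log hK (h n hn)
        rw [Real.log_mul hc.ne' (by positivity), Real.log_pow] at this
        have := le_abs_self (Real.log c)
        push_cast at *
        linarith
    rw [← mul_div_assoc, ← add_div]
    gcongr

lemma AbstractSimplicialComplex.IsUniformlyLocallyFinite.exists_finset_neighbors {V : Type*}
    {X : AbstractSimplicialComplex V} (h : X.IsUniformlyLocallyFinite) :
    ∃ D : ℕ, ∀ v, ∃ s : Finset V, s.card ≤ D ∧ ∀ w, X.oneSkeleton.Adj v w → w ∈ s := by
  classical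
  obtain ⟨D, hD⟩ := h
  refine ⟨D, fun v => ?_⟩
  have hle : {w | X.oneSkeleton.Adj v w}.encard ≤ D := by
    refine le_trans (Set.encard_le_encard_of_injOn (f := fun w => ({v, w} : Finset V)) ?_ ?_)
      (hD v)
    · intro w hw
      refine ⟨?_, by simp⟩
      have := hw.2
      convert this
    · intro w hw w' hw' heq
      have hmem : w ∈ ({v, w'} : Finset V) := by
        have : ({v, w} : Finset V) = {v, w'} := heq
        rw [← this]
        simp
      rcases Finset.mem_insert.mp hmem with h | h
      · exact absurd h.symm hw.1
      · exact Finset.mem_singleton.mp h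
  have hfin : {w | X.oneSkeleton.Adj v w}.Finite := Set.finite_of_encard_le_coe hle
  refine ⟨hfin.toFinset, ?_, fun w hw => by simpa using hw⟩
  rw [hfin.encard_eq_coe_toFinset_card] at hle
  exact_mod_cast hle

/-- A bridged graph of bounded degree whose interval levels are uniformly quasi-isometric to
segments has Property A. For a base point `o`, the decreasing family of sets at `x` consists of
the vertices within `6n` that lie on geodesics to `o` from all vertices of the `k`-ball around
`x`. -/
theorem SimpleGraph.IsBridged.hasPropertyA {V : Type*} {G : SimpleGraph V} (hG : G.IsBridged)
    {D : ℕ} (hdeg : ∀ v, ∃ s : Finset V, s.card ≤ D ∧ ∀ w, G.Adj v w → w ∈ s) {B C : ℝ}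
    (hB : 0 < B) (hC : 0 < C)
    (hq : ∀ u v k, k ≤ G.dist u v → (G.level u v k).IsQuasiSegment B C) :
    @HasPropertyA V (G.pathMetric hG.1) := by
  let _ := G.pathMetric hG.1
  have hdist : ∀ x y : V, Dist.dist x y = (G.dist x y : ℝ) := fun _ _ => rfl
  have hfin : ∀ v, (G.neighborSet v).Finite := fun v => by
    obtain ⟨s, -, hs⟩ := hdeg v
    exact s.finite_toSet.subset fun w hw => hs w hw
  obtain ⟨o⟩ := hG.1.nonempty
  have hX : IsUniformlyDiscreteSpace V := by
    refine ⟨1, one_pos, fun x y hxy => ?_⟩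
    rw [hdist]
    exact_mod_cast hG.1.pos_dist_of_ne hxy
  refine hasPropertyA_of_decreasing hX
    (fun n => (D + 1) ^ ⌊B * C⌋₊ * (2 * ⌊B * (6 * n : ℕ) + C⌋₊ + 1) * (6 * n + 1)) ?_ fun n => ?_
  · refine tendsto_log_div_of_le_sq _
      ((D + 1) ^ ⌊B * C⌋₊ * (2 * (B * 6 + C) + 1) * 7) fun n hn => ?_
    have hn1 : (1 : ℝ) ≤ n := by exact_mod_cast hn
    have h1 : (⌊B * (6 * n : ℕ) + C⌋₊ : ℝ) ≤ B * (6 * n) + C := by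
      have := Nat.floor_le (show 0 ≤ B * (6 * n : ℕ) + C by positivity)
      push_cast at this ⊢
      exact this
    have h2 : (2 * (⌊B * (6 * n : ℕ) + C⌋₊ : ℝ) + 1) ≤ (2 * (B * 6 + C) + 1) * n := by
      nlinarith
    have h3 : (6 * (n : ℝ) + 1) ≤ 7 * n := by linarith
    calc _ = ((D : ℝ) + 1) ^ ⌊B * C⌋₊ *
          ((2 * (⌊B * (6 * n : ℕ) + C⌋₊ : ℝ) + 1) * (6 * n + 1)) := by push_cast; ring
      _ ≤ ((D : ℝ) + 1) ^ ⌊B * C⌋₊ * (((2 * (B * 6 + C) + 1) * n) * (7 * n)) := by gcongr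
      _ = _ := by ring
  · have hFfin : ∀ x k, {z | ∀ y, G.dist x y ≤ k → z ∈ G.interval y o ∧
        G.dist y z ≤ 6 * n}.Finite := by
      intro x k
      obtain ⟨s, -, hs⟩ := hG.1.exists_finset_ball hdeg x (6 * n)
      exact s.finite_toSet.subset fun z hz => hs z (hz x (by simp)).2
    refine ⟨fun x k => (hFfin x k).toFinset, (6 * n : ℕ), ?_, ?_, ?_, ?_⟩
    · intro x y k R hxy z hz
      rw [hdist] at hxy
      have hxy' : G.dist x y ≤ R := by exact_mod_cast hxy
      simp only [Set.Finite.mem_toFinset, Set.mem_ofPred_eq] at hz ⊢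
      intro y' hy'
      have := hG.1.dist_triangle (u := x) (v := y) (w := y')
      exact hz y' (by omega)
    · intro x k hk
      obtain ⟨z, hz⟩ := hG.exists_mem_interval_of_ball hfin o x k
      refine ⟨z, ?_⟩
      simp only [Set.Finite.mem_toFinset, Set.mem_ofPred_eq]
      exact fun y hy => ⟨(hz y hy).1, (hz y hy).2.trans (by omega)⟩
    · intro x
      refine hG.card_le_of_subset_interval hdeg hB hq (x := x) (o := o) _ fun z hz => ?_
      simp only [Set.Finite.mem_toFinset, Set.mem_ofPred_eq] at hz
      exact hz x (by simp)
    · intro x z hz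
      simp only [Set.Finite.mem_toFinset, Set.mem_ofPred_eq] at hz
      rw [hdist, G.dist_comm]
      exact_mod_cast (hz x (by simp)).2

theorem mainTheorem1 {V : Type*} (X : AbstractSimplicialComplex V)
    (hsys : X.IsSystolic) (hulf : X.IsUniformlyLocallyFinite) (hfit : X.IsFit) :
    @HasPropertyA V (X.oneSkeleton.pathMetric hsys.isBridged.1) := by
  obtain ⟨D, hD⟩ := hulf.exists_finset_neighbors
  obtain ⟨B, C, hB, hC, hq⟩ := hfit
  exact hsys.isBridged.hasPropertyA hD hB hC hq
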